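/- A partition of a nonnegative integer $n$ is a nonincreasing sequence of positive integers whose sum is $n$. An overpartition of $n$ is a partition of $n$ in which the first occurrence of each distinct part may be overlined. Let $\overline{p}(n)$ denote the number of overpartitions of $n$ (so $\overline{p}(0)=1$). Then for all integers $n\ge 0$, $$\overline{p}(5n)\equiv(-1)^n\,\overline{p}(4\cdot 5n)\pmod 5.$$ -/

import Mathlib

/-- An overpartition of `n`: a partition of `n` in which the first occurrence of each distinct part
may be overlined. It is recorded as the underlying partition together with the set of those part
sizes whose first occurrence is overlined. -/
@[ext]
structure Overpartition (n : ℕ) where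
  /-- the underlying partition of `n` -/
  toPartition : n.Partition
  /-- the part sizes whose first occurrence is overlined -/
  overlined : Finset ℕ
  /-- only sizes that occur as parts can be overlined -/
  overlined_subset : overlined ⊆ toPartition.parts.toFinset

/-- An overpartition is a partition together with a subset of its set of distinct parts. -/
def Overpartition.equivSigma (n : ℕ) :
    Overpartition n ≃ (Σ p : n.Partition, {s : Finset ℕ // s ∈ p.parts.toFinset.powerset}) where
  toFun o := ⟨o.toPartition, o.overlined, Finset.mem_powerset.mpr o.overlined_subset⟩
  invFun x := ⟨x.1, x.2.1, Finset.mem_powerset.mp x.2.2⟩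
  left_inv _ := rfl
  right_inv _ := rfl

instance Overpartition.instFintype (n : ℕ) : Fintype (Overpartition n) :=
  Fintype.ofEquiv _ (Overpartition.equivSigma n).symm

/-- The number of overpartitions of `n`. -/
def overpartitionCount (n : ℕ) : ℕ := Fintype.card (Overpartition n)

/-!
Write `φ(q) = ∑ q ^ (k ^ 2)`, the sum being over all integers `k`, and let `r_d(n)` be the number
of representations of `n` as a sum of `d` squares, so that `φ(-q) ^ d = ∑ (-1) ^ n r_d(n) q ^ n`.

The generating function of overpartitions is `P(q) = ∏ (1 + q ^ i) / (1 - q ^ i)`, and Gauss's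
identity says that `P(q) φ(-q) = 1` (`overpartitionSeries_mul_evalNegHom_thetaSeries`). It follows
from a finite form of the Rogers–Fine identity, whose iteration shows that the partial products of
`1 / P` agree with the partial sums of `φ(-q)` to higher and higher order
(`pow_dvd_sub_sum_of_recurrence`).

Modulo `5` one has `φ(-q) ^ 5 = φ(-q ^ 5)`, hence `P(q) φ(-q ^ 5) = φ(-q) ^ 4`. Comparing the
coefficients of index `5n` gives `(∑ p̄(5n) q ^ n) φ(-q) = ∑ (-1) ^ n r_4(5n) q ^ n`. Since
`r_4(5n) ≡ r_4(n)` modulo `5` (`card_squareTuples_four_mul_five`), the right-hand side is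
`φ(-q) ^ 4`, and cancelling `φ(-q)` yields `p̄(5n) ≡ (-1) ^ n r_3(n)` (`overpartitionCount_five_mul`). The
theorem is then the equality `r_3(4n) = r_3(n)` (`card_squareTuples_three_mul_four`).

The congruence for `r_4` comes from the integer quaternions: a quaternion whose norm is divisible
by `5` is left divisible by all six of `1 ± 2i`, `1 ± 2j`, `1 ± 2k` if it is divisible by `5`, and
by exactly one of them otherwise. This is a statement about quaternions over `ZMod 5`, checked by
enumeration.
-/

open Finset PowerSeries

/-! ### A finite Rogers–Fine transformation -/

section RogersFine
variable {A : Type*} [CommRing A]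

/-- With `a = q ^ N`, `u = q ^ (N + n + 1)`, `P = P (N + n)` and `P' = P (N + n + 1)`, the `n`-th
term of the sums in `sum_telescope` is the difference of the values at `n` and `n + 1` of
`P (N + n) q ^ (N n) (1 - q ^ (2 N + 1 + n))`, both sides being divided by `q ^ (N n)`. -/
lemma telescope_step {q a u P P' : A} (h : P' * (1 + u) = P * (1 - u)) :
    (1 - a) * P + a * u * (1 + a * q) * P' = P * (1 - a * u) - a * (P' * (1 - a * q * u)) := by
  linear_combination a * h

/-- A finite Rogers–Fine transformation: it links the sum `∑ P (N + n) q ^ (N n)` to the same sum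
for `N + 1`, up to a boundary term divisible by `q ^ (N M)`. -/
lemma sum_telescope {q : A} {P : ℕ → A}
    (hP : ∀ n, P (n + 1) * (1 + q ^ (n + 1)) = P n * (1 - q ^ (n + 1))) (N M : ℕ) :
    (1 - q ^ N) * ∑ n ∈ range M, P (N + n) * q ^ (N * n) +
      q ^ (2 * N + 1) * ((1 + q ^ (N + 1)) * ∑ n ∈ range M, P (N + 1 + n) * q ^ ((N + 1) * n)) =
    P N * (1 - q ^ (2 * N + 1)) - P (N + M) * q ^ (N * M) * (1 - q ^ (2 * N + 1 + M)) := by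
  induction M with
  | zero => simp
  | succ M ih =>
    rw [sum_range_succ, sum_range_succ, show N + 1 + M = N + M + 1 by ring, ← add_assoc N M 1]
    have h := telescope_step (q := q) (a := q ^ N) (hP (N + M))
    linear_combination ih + q ^ (N * M) * h

/-- If `P n = ∏ (1 - q ^ i) / (1 + q ^ i)` over `1 ≤ i ≤ n`, with inverse `R n`, then `P M` agrees
modulo `q ^ M` with a partial sum of `1 + 2 ∑ (-1) ^ n q ^ (n ^ 2)`. The sum below counts the last
square `M ^ 2` once instead of twice. -/
theorem pow_dvd_sub_sum_of_recurrence {q : A} {P R : ℕ → A} (hPR : ∀ n, P n * R n = 1)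
    (hR0 : R 0 = 1) (hR : ∀ n, R (n + 1) * (1 - q ^ (n + 1)) = R n * (1 + q ^ (n + 1))) (M : ℕ) :
    q ^ M ∣ P M - ∑ n ∈ range M, (-1) ^ n * (q ^ n ^ 2 - q ^ (n + 1) ^ 2) := by
  obtain _ | M := M
  · simp
  have hP (n : ℕ) : P (n + 1) * (1 + q ^ (n + 1)) = P n * (1 - q ^ (n + 1)) := by
    linear_combination -P n * P (n + 1) * hR n - P (n + 1) * (1 + q ^ (n + 1)) * hPR n +
      P n * (1 - q ^ (n + 1)) * hPR (n + 1)
  set m := M + 1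
  -- Normalised by `R N`, the transformation reads `E N = 1 - q ^ (2 * N + 1) - q ^ (2 * N + 1) *
  -- E (N + 1)` up to the boundary term, and the exponents `2 * N + 1` add up to squares.
  let E (N : ℕ) : A := R N * (1 - q ^ N) * ∑ n ∈ range m, P (N + n) * q ^ (N * n)
  have hE (N : ℕ) : E N = 1 - q ^ (2 * N + 1) - q ^ (2 * N + 1) * E (N + 1) -
      R N * P (N + m) * q ^ (N * m) * (1 - q ^ (2 * N + 1 + m)) := by
    have h := sum_telescope hP N m
    simp only [E]
    linear_combination R N * h + (1 - q ^ (2 * N + 1)) * hPR N +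
      q ^ (2 * N + 1) * (∑ n ∈ range m, P (N + 1 + n) * q ^ ((N + 1) * n)) * hR N
  have key (K : ℕ) : q ^ m ∣ P m * (1 - q ^ (m + 1)) -
      (∑ n ∈ range (K + 1), (-1) ^ n * (q ^ n ^ 2 - q ^ (n + 1) ^ 2) +
        (-1) ^ (K + 1) * q ^ (K + 1) ^ 2 * E (K + 1)) := by
    induction K with
    | zero =>
      have h0 := hE 0
      -- For `N = 0` the boundary term is not divisible by `q`: it is `P m * (1 - q ^ (m + 1))`.
      have : E 0 = 0 := by simp [E]
      rw [this, hR0] at h0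
      refine ⟨0, ?_⟩
      simp only [Nat.zero_add, Nat.mul_zero, Nat.zero_mul, Nat.add_comm 1 m, pow_zero] at h0
      simp
      linear_combination h0
    | succ K ih =>
      obtain ⟨c, hc⟩ := ih
      rw [sum_range_succ]
      refine ⟨c + (-1) ^ (K + 1) * q ^ (K + 1) ^ 2 * (-(R (K + 1) * P (K + 1 + m) * q ^ (K * m) *
        (1 - q ^ (2 * (K + 1) + 1 + m)))), ?_⟩
      linear_combination hc + (-1) ^ (K + 1) * q ^ (K + 1) ^ 2 * hE (K + 1)
  have h1 := key M
  have h2 : q ^ m ∣ (-1) ^ (M + 1) * q ^ (M + 1) ^ 2 * E (M + 1) :=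
    ((pow_dvd_pow q (Nat.le_self_pow two_ne_zero _)).mul_left _).mul_right _
  have h3 : q ^ m ∣ P m * q ^ (m + 1) := (pow_dvd_pow q (by omega)).mul_left _
  convert (h1.add h2).add h3 using 1
  ring

end RogersFine

/-! ### Sums of squares and the theta series -/

/-- The `d`-tuples of integers whose squares sum to `n`; restricting the entries to `[-n, n]` loses
none of them, see `mem_squareTuples`. -/
noncomputable def squareTuples (d n : ℕ) : Finset (Fin d → ℤ) :=
  {x ∈ Fintype.piFinset fun _ ↦ Icc (-n : ℤ) n | ∑ i, x i ^ 2 = n}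

lemma mem_squareTuples {d n : ℕ} {x : Fin d → ℤ} :
    x ∈ squareTuples d n ↔ ∑ i, x i ^ 2 = n := by
  simp only [squareTuples, mem_filter, Fintype.mem_piFinset, mem_Icc, ← abs_le,
    and_iff_right_iff_imp]
  intro h i
  have h1 : x i ^ 2 ≤ n :=
    h ▸ single_le_sum (f := fun i ↦ x i ^ 2) (fun _ _ ↦ sq_nonneg _) (mem_univ i)
  have h2 : |x i| ≤ x i ^ 2 := by simpa using Int.le_self_sq |x i|
  exact h2.trans h1

section Theta
variable (R : Type*) [CommRing R]

/-- The theta series `∑ X ^ (k ^ 2)` over all integers `k`, given by its coefficients: the `n`-th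
one is the number of integers with square `n`. -/
noncomputable def thetaSeries : R⟦X⟧ :=
  PowerSeries.mk fun n : ℕ ↦ (#{k ∈ Icc (-n : ℤ) n | k ^ 2 = (n : ℤ)} : R)

lemma coeff_sum_X_pow_sq {n B : ℕ} (h : n ≤ B) :
    coeff n (∑ k ∈ Icc (-B : ℤ) B, (X : R⟦X⟧) ^ (k ^ 2).natAbs) = coeff n (thetaSeries R) := by
  simp only [thetaSeries, coeff_mk, map_sum, coeff_X_pow, sum_boole]
  congr 2
  ext k
  simp only [mem_filter, mem_Icc, ← abs_le]
  have h2 : |k| ≤ k ^ 2 := by simpa using Int.le_self_sq |k|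
  have h3 : ((k ^ 2).natAbs : ℤ) = k ^ 2 := Int.natAbs_of_nonneg (sq_nonneg k)
  omega

theorem coeff_thetaSeries_pow (d n : ℕ) :
    coeff n (thetaSeries R ^ d) = (#(squareTuples d n) : R) := by
  have h : (X : R⟦X⟧) ^ (n + 1) ∣
      thetaSeries R - ∑ k ∈ Icc (-n : ℤ) n, (X : R⟦X⟧) ^ (k ^ 2).natAbs := by
    rw [X_pow_dvd_iff]
    intro m hm
    rw [map_sub, coeff_sum_X_pow_sq R (Nat.lt_succ_iff.mp hm), sub_self]
  have h1 := X_pow_dvd_iff.mp (h.trans (sub_dvd_pow_sub_pow _ _ d)) n n.lt_succ_self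
  rw [map_sub, sub_eq_zero] at h1
  rw [h1, sum_pow', map_sum]
  simp only [prod_pow_eq_pow_sum, coeff_X_pow, sum_boole, squareTuples]
  congr 2
  ext x
  simp only [mem_filter, and_congr_right_iff]
  intro _
  have h3 : ((∑ i, (x i ^ 2).natAbs : ℕ) : ℤ) = ∑ i, x i ^ 2 := by
    push_cast
    exact sum_congr rfl fun i _ ↦ abs_of_nonneg (sq_nonneg _)
  rw [← h3, eq_comm]
  norm_cast

theorem coeff_evalNegHom (f : R⟦X⟧) (n : ℕ) : coeff n (evalNegHom f) = (-1) ^ n * coeff n f := by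
  simp [evalNegHom, coeff_rescale]

/-- The last square `K ^ 2`, which occurs twice in the symmetric sum over `[-K, K]` and once on the
left, accounts for the correction term. -/
theorem sum_alternating_squares (K : ℕ) :
    ∑ n ∈ range K, (-1) ^ n * ((X : R⟦X⟧) ^ n ^ 2 - X ^ (n + 1) ^ 2) =
      evalNegHom (∑ k ∈ Icc (-K : ℤ) K, (X : R⟦X⟧) ^ (k ^ 2).natAbs) - (-1) ^ K * X ^ K ^ 2 := by
  have hs (n : ℕ) : (-1 : R⟦X⟧) ^ n ^ 2 = (-1) ^ n := by
    rcases n.even_or_odd with h | h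
    · rw [h.neg_one_pow, (h.pow_of_ne_zero two_ne_zero).neg_one_pow]
    · rw [h.neg_one_pow, h.pow.neg_one_pow]
  induction K with
  | zero => simp
  | succ K ih =>
    have hI : Icc (-(K + 1 : ℕ) : ℤ) (K + 1 : ℕ) =
        insert (-(K + 1 : ℕ) : ℤ) (insert ((K + 1 : ℕ) : ℤ) (Icc (-K : ℤ) K)) := by
      ext k; simp only [mem_Icc, mem_insert]; omega
    rw [sum_range_succ, ih, hI, sum_insert (by simp; omega), sum_insert (by simp), map_add, map_add]
    have hn : (((K + 1 : ℕ) : ℤ) ^ 2).natAbs = (K + 1) ^ 2 := by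
      rw [Int.natAbs_pow, Int.natAbs_natCast]
    rw [neg_sq, hn, map_pow, evalNegHom_X, neg_pow X, hs (K + 1)]
    ring

theorem coeff_sum_alternating_squares {d K : ℕ} (h : d < K) :
    coeff d (∑ n ∈ range K, (-1) ^ n * ((X : R⟦X⟧) ^ n ^ 2 - X ^ (n + 1) ^ 2)) =
      coeff d (evalNegHom (thetaSeries R)) := by
  have h1 : (X : R⟦X⟧) ^ (d + 1) ∣ (-1) ^ K * X ^ K ^ 2 :=
    (pow_dvd_pow X (by nlinarith)).mul_left _
  rw [sum_alternating_squares, map_sub, X_pow_dvd_iff.mp h1 d d.lt_succ_self, sub_zero,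
    coeff_evalNegHom, coeff_evalNegHom, coeff_sum_X_pow_sq R h.le]

end Theta

/-! ### Sums of four squares modulo 5 and of three squares -/

section Quaternion
variable {R S : Type*} [CommRing R] [CommRing S]

/-- The product of two quaternions given by their coordinates with respect to `1, i, j, k`.
Plain 4-tuples are used because they are what `squareTuples` consists of. -/
def quatMul (a x : Fin 4 → R) : Fin 4 → R :=
  ![a 0 * x 0 - a 1 * x 1 - a 2 * x 2 - a 3 * x 3,
    a 0 * x 1 + a 1 * x 0 + a 2 * x 3 - a 3 * x 2,
    a 0 * x 2 - a 1 * x 3 + a 2 * x 0 + a 3 * x 1,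
    a 0 * x 3 + a 1 * x 2 - a 2 * x 1 + a 3 * x 0]

/-- The conjugate of a quaternion given by its coordinates. -/
def quatConj (a : Fin 4 → R) : Fin 4 → R := ![a 0, -a 1, -a 2, -a 3]

lemma quatConj_quatConj (a : Fin 4 → R) : quatConj (quatConj a) = a := by
  ext j; fin_cases j <;> simp [quatConj]

lemma sum_sq_quatConj (a : Fin 4 → R) : ∑ j, quatConj a j ^ 2 = ∑ j, a j ^ 2 := by
  simp [quatConj, Fin.sum_univ_four]

lemma quatConj_mul_mul (a x : Fin 4 → R) :
    quatMul (quatConj a) (quatMul a x) = (∑ j, a j ^ 2) • x := by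
  ext j; fin_cases j <;> simp [quatConj, quatMul, Fin.sum_univ_four] <;> ring

lemma sum_sq_quatMul (a x : Fin 4 → R) :
    ∑ j, quatMul a x j ^ 2 = (∑ j, a j ^ 2) * ∑ j, x j ^ 2 := by
  simp only [quatMul, Fin.sum_univ_four, Matrix.cons_val]
  ring

lemma quatMul_smul (a x : Fin 4 → R) (c : R) : quatMul a (c • x) = c • quatMul a x := by
  ext j; fin_cases j <;> simp [quatMul] <;> ring

lemma map_quatConj_mul (f : R →+* S) (a x : Fin 4 → R) :
    f ∘ quatMul (quatConj a) x = quatMul (quatConj (f ∘ a)) (f ∘ x) := by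
  ext j; fin_cases j <;> simp [quatConj, quatMul]

/-- The quaternions `1 ± 2i`, `1 ± 2j`, `1 ± 2k`: representatives of the integer quaternions of norm
`5` up to right multiplication by the units `±1, ±i, ±j, ±k`. -/
def normFive : Fin 6 → Fin 4 → ℤ :=
  ![![1, 2, 0, 0], ![1, -2, 0, 0], ![1, 0, 2, 0], ![1, 0, -2, 0], ![1, 0, 0, 2], ![1, 0, 0, -2]]

lemma sum_sq_normFive (i : Fin 6) : ∑ j, normFive i j ^ 2 = 5 := by
  revert i; decide

/-- An isotropic quaternion modulo `5` is annihilated by all six conjugates if it is zero, and by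
exactly one of them otherwise; both `6` and `1` are `1` modulo `5`. -/
lemma card_isotropic : ∀ x : Fin 4 → ZMod 5, ∑ j, x j ^ 2 = 0 →
    ((#{i : Fin 6 | quatMul (quatConj (Int.castRingHom (ZMod 5) ∘ normFive i)) x = 0} : ℕ) :
      ZMod 5) = 1 := by
  decide +kernel

/-- Left divisibility by a quaternion `α` of norm `5` can be tested modulo `5`: `x = α y` if and
only if `5` divides `conj α * x`. -/
lemma exists_eq_quatMul_iff (i : Fin 6) (x : Fin 4 → ℤ) :
    (∃ y, quatMul (normFive i) y = x) ↔
      quatMul (quatConj (Int.castRingHom (ZMod 5) ∘ normFive i))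
        (Int.castRingHom (ZMod 5) ∘ x) = 0 := by
  rw [← map_quatConj_mul]
  constructor
  · rintro ⟨y, rfl⟩
    rw [quatConj_mul_mul, sum_sq_normFive]
    ext j
    simp [show (5 : ZMod 5) = 0 from rfl]
  · intro h
    have h5 (j : Fin 4) : (5 : ℤ) ∣ quatMul (quatConj (normFive i)) x j :=
      (ZMod.intCast_zmod_eq_zero_iff_dvd _ 5).mp (congrFun h j)
    choose y hy using h5
    refine ⟨y, ?_⟩
    have hy' : quatMul (quatConj (normFive i)) x = (5 : ℤ) • y := funext hy
    have h1 := quatConj_mul_mul (quatConj (normFive i)) x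
    rw [quatConj_quatConj, sum_sq_quatConj, sum_sq_normFive, hy', quatMul_smul] at h1
    exact smul_right_injective _ (by norm_num : (5 : ℤ) ≠ 0) h1

/-- `r₄(5n) ≡ r₄(n)` modulo `5`, by counting in two ways the pairs of a quaternion `x` of norm `5n`
and a left divisor of `x` among the six quaternions `normFive i`. -/
theorem card_squareTuples_four_mul_five (n : ℕ) :
    (#(squareTuples 4 (5 * n)) : ZMod 5) = #(squareTuples 4 n) := by
  classical
  have hcard (i : Fin 6) :
      #{x ∈ squareTuples 4 (5 * n) | ∃ y, quatMul (normFive i) y = x} = #(squareTuples 4 n) := by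
    symm
    refine card_bij (fun y _ ↦ quatMul (normFive i) y) ?_ ?_ ?_
    · intro y hy
      rw [mem_squareTuples] at hy
      simp [mem_squareTuples, sum_sq_quatMul, sum_sq_normFive, hy]
    · intro y _ z _ h
      have h1 := congrArg (quatMul (quatConj (normFive i))) h
      simp only [quatConj_mul_mul, sum_sq_normFive] at h1
      exact smul_right_injective _ (by norm_num : (5 : ℤ) ≠ 0) h1
    · intro x hx
      obtain ⟨hx, y, rfl⟩ := mem_filter.mp hx
      rw [mem_squareTuples, sum_sq_quatMul, sum_sq_normFive] at hx
      refine ⟨y, mem_squareTuples.mpr ?_, rfl⟩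
      push_cast at hx
      linarith
  have hone : ∀ x ∈ squareTuples 4 (5 * n),
      ((#{i : Fin 6 | ∃ y, quatMul (normFive i) y = x} : ℕ) : ZMod 5) = 1 := by
    intro x hx
    simp only [exists_eq_quatMul_iff]
    convert card_isotropic _ ?_
    have h := congrArg (Int.castRingHom (ZMod 5)) (mem_squareTuples.mp hx)
    simpa [show (5 : ZMod 5) = 0 from rfl] using h
  calc (#(squareTuples 4 (5 * n)) : ZMod 5)
      = ∑ x ∈ squareTuples 4 (5 * n),
          ((#{i : Fin 6 | ∃ y, quatMul (normFive i) y = x} : ℕ) : ZMod 5) := by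
        rw [sum_congr rfl hone]; simp
    _ = ((∑ i : Fin 6, #{x ∈ squareTuples 4 (5 * n) | ∃ y, quatMul (normFive i) y = x} : ℕ) :
          ZMod 5) := by
        rw [← Nat.cast_sum]
        congr 1
        exact sum_card_bipartiteAbove_eq_sum_card_bipartiteBelow
          (fun (x : Fin 4 → ℤ) (i : Fin 6) ↦ ∃ y, quatMul (normFive i) y = x)
    _ = #(squareTuples 4 n) := by
        simp only [hcard, sum_const, card_univ, Fintype.card_fin, smul_eq_mul, Nat.cast_mul]
        rw [show ((6 : ℕ) : ZMod 5) = 1 from rfl, one_mul]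

end Quaternion

/-- `r₃(4n) = r₃(n)`: three squares with sum divisible by `4` are all even, since squares are `0`
or `1` modulo `4`. -/
theorem card_squareTuples_three_mul_four (n : ℕ) :
    #(squareTuples 3 (4 * n)) = #(squareTuples 3 n) := by
  symm
  refine card_bij (fun y _ ↦ (2 : ℤ) • y) ?_ ?_ ?_
  · intro y hy
    rw [mem_squareTuples] at hy ⊢
    simp only [Pi.smul_apply, smul_eq_mul, mul_pow, ← mul_sum, hy]
    norm_num
  · intro y _ z _ h
    exact smul_right_injective _ (by norm_num : (2 : ℤ) ≠ 0) h
  · intro x hx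
    rw [mem_squareTuples] at hx
    have hmod : ∀ y : Fin 3 → ZMod 4, ∑ j, y j ^ 2 = 0 → ∀ j, y j = 0 ∨ y j = 2 := by decide
    have h2 (j : Fin 3) : (2 : ℤ) ∣ x j := by
      have h := hmod (fun j ↦ x j) (by
        have h := congrArg (Int.castRingHom (ZMod 4)) hx
        simpa [show (4 : ZMod 4) = 0 from rfl] using h) j
      rcases h with h | h
      · exact dvd_trans (by norm_num) ((ZMod.intCast_zmod_eq_zero_iff_dvd _ 4).mp h)
      · have h4 : ((x j - 2 : ℤ) : ZMod 4) = 0 := by push_cast; rw [h]; rfl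
        have := (ZMod.intCast_zmod_eq_zero_iff_dvd _ 4).mp h4
        omega
    choose y hy using h2
    refine ⟨y, ?_, (funext hy).symm⟩
    rw [mem_squareTuples]
    simp only [hy, mul_pow, ← mul_sum] at hx
    push_cast at hx
    linarith

/-! ### The generating function of overpartitions -/

lemma card_overpartition (n : ℕ) :
    overpartitionCount n = ∑ p : n.Partition, 2 ^ #p.parts.toFinset := by
  rw [overpartitionCount, Fintype.card_congr (Overpartition.equivSigma n), Fintype.card_sigma]
  exact sum_congr rfl fun p _ ↦ by rw [Fintype.card_coe, card_powerset]

section Series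
variable (R : Type*)

/-- The generating function of the number of overpartitions, with coefficients in `R`. -/
noncomputable def overpartitionSeries [CommRing R] : R⟦X⟧ :=
  PowerSeries.mk fun n ↦ (overpartitionCount n : R)

lemma overpartitionSeries_eq_genFun [CommRing R] :
    overpartitionSeries R = Nat.Partition.genFun fun _ _ ↦ (2 : R) := by
  ext n
  rw [Nat.Partition.coeff_genFun, overpartitionSeries, coeff_mk, card_overpartition]
  push_cast
  refine sum_congr rfl fun p _ ↦ ?_
  simp [Finsupp.prod]

open PowerSeries.WithPiTopology in
/-- The contribution of the part `i + 1` to the generating function of overpartitions is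
`(1 + X ^ (i + 1)) / (1 - X ^ (i + 1))`. -/
lemma one_add_tsum_mul_one_sub [CommRing R] [TopologicalSpace R] [T2Space R]
    [IsTopologicalRing R] (i : ℕ) :
    (1 + ∑' j, (2 : R) • (X : R⟦X⟧) ^ ((i + 1) * (j + 1))) * (1 - X ^ (i + 1)) =
      1 + X ^ (i + 1) := by
  have h0 : constantCoeff ((X : R⟦X⟧) ^ (i + 1)) = 0 := by simp
  have h1 := tsum_pow_mul_one_sub_of_constantCoeff_eq_zero h0
  have h2 : ∑' j, (2 : R) • (X : R⟦X⟧) ^ ((i + 1) * (j + 1)) =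
      2 * X ^ (i + 1) * ∑' j, ((X : R⟦X⟧) ^ (i + 1)) ^ j := by
    rw [← (summable_pow_of_constantCoeff_eq_zero h0).tsum_mul_left]
    refine tsum_congr fun j ↦ ?_
    rw [PowerSeries.smul_eq_C_mul, map_ofNat]
    ring
  rw [h2]
  linear_combination 2 * X ^ (i + 1) * h1

end Series

/-! ### Gauss's identity -/

section GaussIdentity
variable (k : Type*) [Field k]

open PowerSeries.WithPiTopology in
/-- Gauss's identity: `∏ (1 - q ^ i) / (1 + q ^ i) = ∑ (-1) ^ k q ^ (k ^ 2)`, the sum being over all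
integers, so that the generating function of overpartitions is the inverse of the theta series at
`-q`. -/
theorem overpartitionSeries_mul_evalNegHom_thetaSeries :
    overpartitionSeries k * evalNegHom (thetaSeries k) = 1 := by
  -- With `k` discrete, convergence in `k⟦X⟧` means that each coefficient is eventually constant.
  let _ : TopologicalSpace k := ⊥
  have _ : DiscreteTopology k := ⟨rfl⟩
  let F (i : ℕ) : k⟦X⟧ := 1 + ∑' j, (2 : k) • (X : k⟦X⟧) ^ ((i + 1) * (j + 1))
  have hF (i : ℕ) : F i * (1 - X ^ (i + 1)) = 1 + X ^ (i + 1) := one_add_tsum_mul_one_sub k i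
  let Q (n : ℕ) : k⟦X⟧ := ∏ i ∈ range n, F i
  have hQ0 (n : ℕ) : constantCoeff (Q n) ≠ 0 := by
    have h (i : ℕ) : constantCoeff (F i) = 1 := by
      simpa using congrArg (constantCoeff (R := k)) (hF i)
    simp [Q, map_prod, h]
  have hQ (n : ℕ) : Q (n + 1) * (1 - X ^ (n + 1)) = Q n * (1 + X ^ (n + 1)) := by
    simp only [Q, prod_range_succ]
    rw [mul_assoc, hF]
  have hPQ (n : ℕ) : (Q n)⁻¹ * Q n = 1 := PowerSeries.inv_mul_cancel _ (hQ0 n)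
  have h1 : Filter.Tendsto Q Filter.atTop (nhds (overpartitionSeries k)) := by
    rw [overpartitionSeries_eq_genFun]
    exact (Nat.Partition.hasProd_genFun fun _ _ ↦ (2 : k)).tendsto_prod_nat
  have h2 : Filter.Tendsto (fun n ↦ (Q n)⁻¹) Filter.atTop (nhds (evalNegHom (thetaSeries k))) := by
    rw [tendsto_iff_coeff_tendsto]
    intro d
    refine tendsto_atTop_of_eventually_const (i₀ := d + 1) fun M hM ↦ ?_
    have h := X_pow_dvd_iff.mp (pow_dvd_sub_sum_of_recurrence hPQ (by simp [Q]) hQ M) d hM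
    rw [map_sub, sub_eq_zero] at h
    rw [h, coeff_sum_alternating_squares k hM]
  refine tendsto_nhds_unique (h1.mul h2) ?_
  simp only [mul_comm (Q _), hPQ]
  exact tendsto_const_nhds

end GaussIdentity

/-! ### Extracting the coefficients of index divisible by 5 -/

/-- Selecting the coefficients with index divisible by `p` commutes with multiplication by a power
series in `X ^ p`. -/
theorem mk_coeff_mul_expand {R : Type*} [CommRing R] {p : ℕ} (hp : p ≠ 0) (f g : R⟦X⟧) :
    PowerSeries.mk (fun n ↦ coeff (p * n) (f * expand p hp g)) =
      PowerSeries.mk (fun n ↦ coeff (p * n) f) * g := by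
  ext n
  rw [coeff_mk, coeff_mul, coeff_mul]
  symm
  refine sum_of_injOn (fun a ↦ (p * a.1, p * a.2)) ?_ ?_ ?_ ?_
  · intro a _ b _ h
    simpa [hp, Prod.ext_iff] using h
  · intro a ha
    rw [mem_coe, HasAntidiagonal.mem_antidiagonal] at ha ⊢
    rw [← ha, mul_add]
  · intro a ha hn
    rw [coeff_expand_of_not_dvd, mul_zero]
    rintro ⟨c, hc⟩
    rw [HasAntidiagonal.mem_antidiagonal] at ha
    obtain ⟨b, hb⟩ : p ∣ a.1 := (Nat.dvd_add_left ⟨c, hc⟩).mp ⟨n, ha⟩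
    refine hn ⟨(b, c), ?_, by ext <;> simp [hb, hc]⟩
    rw [mem_coe, HasAntidiagonal.mem_antidiagonal]
    rw [hb, hc, ← mul_add] at ha
    exact Nat.eq_of_mul_eq_mul_left (Nat.pos_of_ne_zero hp) ha
  · intro a _
    simp

theorem expand_eq_pow (p : ℕ) [Fact p.Prime] (f : (ZMod p)⟦X⟧) :
    expand p (NeZero.ne p) f = f ^ p := by
  have h := MvPowerSeries.map_frobenius_expand p (NeZero.ne p) (f := f)
  rwa [ZMod.frobenius_zmod, MvPowerSeries.map_id] at h

/-- Modulo `5`, the number of overpartitions of `5n` is `(-1) ^ n` times the number of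
representations of `n` as a sum of three squares. -/
theorem overpartitionCount_five_mul (n : ℕ) :
    (overpartitionCount (5 * n) : ZMod 5) = (-1) ^ n * #(squareTuples 3 n) := by
  have : Fact (Nat.Prime 5) := ⟨by norm_num⟩
  set f := overpartitionSeries (ZMod 5) with hf
  set g := evalNegHom (thetaSeries (ZMod 5)) with hg
  have hfg : f * g = 1 := overpartitionSeries_mul_evalNegHom_thetaSeries (ZMod 5)
  have hcoeff (d m : ℕ) : coeff m (g ^ d) = (-1) ^ m * (#(squareTuples d m) : ZMod 5) := by
    rw [hg, ← map_pow, coeff_evalNegHom, coeff_thetaSeries_pow]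
  have h4 : f * expand 5 (NeZero.ne 5) g = g ^ 4 := by
    rw [expand_eq_pow 5]
    linear_combination g ^ 4 * hfg
  have h5 : PowerSeries.mk (fun n ↦ coeff (5 * n) f) * g = g ^ 4 := by
    rw [← mk_coeff_mul_expand (NeZero.ne 5), h4]
    ext m
    rw [coeff_mk, hcoeff, hcoeff, card_squareTuples_four_mul_five, pow_mul]
    norm_num
  -- Multiply `h5` by `f`, the inverse of `g`.
  have h3 : PowerSeries.mk (fun n ↦ coeff (5 * n) f) = g ^ 3 := by
    linear_combination f * h5 + (g ^ 3 - PowerSeries.mk (fun n ↦ coeff (5 * n) f)) * hfg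
  have h := congrArg (coeff n) h3
  rwa [coeff_mk, hcoeff, hf, overpartitionSeries, coeff_mk] at h

theorem mainTheorem5 (n : ℕ) :
    (overpartitionCount (5 * n) : ℤ) ≡
      (-1) ^ n * (overpartitionCount (4 * (5 * n)) : ℤ) [ZMOD 5] := by
  refine (ZMod.intCast_eq_intCast_iff _ _ 5).mp ?_
  push_cast
  rw [show 4 * (5 * n) = 5 * (4 * n) by ring, overpartitionCount_five_mul,
    overpartitionCount_five_mul, card_squareTuples_three_mul_four, pow_mul (-1) 4 n]
  norm_num
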